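/- Let $I\subset\mathbb R$ be an interval and let $(f_t)_{t\in\Lambda}$, with $\Lambda\subset\mathbb R$ an interval, be a family of differentiable unimodal maps $f_t:I\to I$, all with a maximum or all with a minimum at the critical point $C_t\in\operatorname{int} I$ (each $f_t$ is strictly monotone, in opposite directions, on the two sides of $C_t$), such that $f_t(x)$ and $f_t'(x)$ are continuous in $(t,x)$. Suppose the family goes through a period-doubling cascade: there are parameter values $r_0<r_1<r_2<\cdots$ in $\Lambda$ such that, for every $k\ge 0$, $f_t$ has for $r_k<t<r_{k+1}$ a stable periodic orbit of least period $2^k$ (multiplier of modulus less than $1$) depending continuously on $t\in[r_k,r_{k+1}]$; at $t=r_{k+1}$ this orbit still has least period $2^k$ and has multiplier $-1$, and the orbit of least period $2^{k+1}$ branches off from it there. Let $p\ge 2$ and let $s\in(r_p,r_{p+1})$ be a parameter value at which the $2^p$-periodic orbit of the cascade is superstable, i.e. contains the critical point. Write $f=f_s$ and $C=C_s$, so that the orbit is $\{C,f(C),\dots,f^{2^p-1}(C)\}$, a set of $2^p$ points with $f^{2^p}(C)=C$. For $1\le i\le 2^p$ let $C^*_{(i,2^p)}$ be the $i$-th point of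 this orbit in cardinal order, that is, in descending order if $f$ has a maximum at $C$ and in ascending order if $f$ has a minimum at $C$. For a finite sequence put $R(a_1,\dots,a_n;\alpha)=(a_1,\dots,a_n,a_n+\alpha,a_{n-1}+\alpha,\dots,a_1+\alpha)$ and $$\partial R(a_1,\dots,a_n;2^k)=R(\cdots R(R(a_1,\dots,a_n;2^k);2^{k-1})\cdots;2^0).$$ Let $$\sigma_{2^p}=(\sigma_{(1,2^p)},\dots,\sigma_{(2^p,2^p)})=\partial R(1,2^{p-1}+1;2^{p-2}).$$ Then $\sigma_{2^p}$ is a permutation of $\{1,\dots,2^p\}$ and $$f^{\sigma_{(i,2^p)}}(C)=C^*_{(i,2^p)},\qquad i=1,\dots,2^p.$$ Equivalently, if the orbit is written $\{x_1,\dots,x_{2^p}\}$ with $x_j=f^j(C)$, then $C^*_{(i,2^p)}=x_{\sigma_{(i,2^p)}}$ for $i=1,\dots,2^p$. -/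

import Mathlib

open Set

/-- The kind of extremum that a unimodal map has at its critical point. -/
inductive ExtremumKind where
  | max
  | min

/-- `g` is a differentiable unimodal map of the interval `I` into itself, with critical point `c`
(an interior point of `I`) at which it has its unique maximum, respectively minimum: it is strictly
monotone on each side of `c`, with opposite directions. -/
def IsUnimodal (e : ExtremumKind) (I : Set ℝ) (g : ℝ → ℝ) (c : ℝ) : Prop :=
  MapsTo g I I ∧ c ∈ interior I ∧ DifferentiableOn ℝ g I ∧
    match e with
    | .max => StrictMonoOn g (I ∩ Iic c) ∧ StrictAntiOn g (I ∩ Ici c)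
    | .min => StrictAntiOn g (I ∩ Iic c) ∧ StrictMonoOn g (I ∩ Ici c)

/-- A one-parameter family `t ↦ f t`, `t ∈ Λ`, of unimodal maps of a fixed interval `I`, all of
the same kind, with critical points `c t`, such that `f t x` and its `x`-derivative depend
continuously on `(t, x)`. -/
structure IsUnimodalFamily (e : ExtremumKind) (I Λ : Set ℝ) (f : ℝ → ℝ → ℝ) (c : ℝ → ℝ) :
    Prop where
  interval_I : I.OrdConnected
  interval_Λ : Λ.OrdConnected
  unimodal : ∀ t ∈ Λ, IsUnimodal e I (f t) (c t)
  continuous : ContinuousOn (fun q : ℝ × ℝ => f q.1 q.2) (Λ ×ˢ I)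
  continuous_deriv : ContinuousOn (fun q : ℝ × ℝ => derivWithin (f q.1) I q.2) (Λ ×ˢ I)

/-- The multiplier `(g^n)'(y)` of an `n`-periodic point `y` of `g`, as the product of the
derivatives of `g` along the orbit. -/
noncomputable def multiplier (I : Set ℝ) (g : ℝ → ℝ) (n : ℕ) (y : ℝ) : ℝ :=
  ∏ j ∈ Finset.range n, derivWithin g I (g^[j] y)

/-- The family `f` goes through a period-doubling cascade with bifurcation values
`r 1 < r 2 < ⋯`. For `t` between `r k` and `r (k + 1)` there is a stable periodic orbit of least
period `2 ^ k`, that of the point `x k t`, and it depends continuously on `t` (for `k = 0` this is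
a fixed point, followed from some initial value `r 0`). At `r (k + 1)` it loses its stability, with
multiplier `-1`, and the orbit of twice the period branches off from it. -/
structure IsPeriodDoublingCascade (I Λ : Set ℝ) (f : ℝ → ℝ → ℝ) (r : ℕ → ℝ)
    (x : ℕ → ℝ → ℝ) : Prop where
  strictMono : StrictMono r
  mem_param : ∀ k, r k ∈ Λ
  mem_interval : ∀ k, ∀ t ∈ Icc (r k) (r (k + 1)), x k t ∈ I
  continuous_branch : ∀ k, ContinuousOn (x k) (Icc (r k) (r (k + 1)))
  least_period : ∀ k, ∀ t ∈ Ioc (r k) (r (k + 1)), Function.minimalPeriod (f t) (x k t) = 2 ^ k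
  stable : ∀ k, ∀ t ∈ Ioo (r k) (r (k + 1)), |multiplier I (f t) (2 ^ k) (x k t)| < 1
  flip : ∀ k, multiplier I (f (r (k + 1))) (2 ^ k) (x k (r (k + 1))) = -1
  branching : ∀ k, x (k + 1) (r (k + 1)) = x k (r (k + 1))

/-- At the parameter value `s` the `2 ^ p`-periodic orbit of the cascade is superstable: it contains
the critical point. -/
def IsSuperstableParam (f : ℝ → ℝ → ℝ) (c : ℝ → ℝ) (r : ℕ → ℝ) (x : ℕ → ℝ → ℝ) (p : ℕ)
    (s : ℝ) : Prop :=
  s ∈ Ioo (r p) (r (p + 1)) ∧ ∃ j : ℕ, (f s)^[j] (x p s) = c s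

/-- The points `c, g c, …, g^(q-1) c`. -/
noncomputable def orbitPoints (g : ℝ → ℝ) (c : ℝ) (q : ℕ) : Finset ℝ :=
  (Finset.range q).image fun j => g^[j] c

/-- The points `c, g c, …, g^(q-1) c` in cardinal order: descending for a maximum, ascending for
a minimum. -/
noncomputable def cardinalList (e : ExtremumKind) (g : ℝ → ℝ) (c : ℝ) (q : ℕ) : List ℝ :=
  match e with
  | .max => (orbitPoints g c q).sort (· ≥ ·)
  | .min => (orbitPoints g c q).sort (· ≤ ·)

/-- `C*_(i,q)`, the point in the `i`-th cardinal position, `1 ≤ i ≤ q` (the default value `0` is not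
used when the `q` points are distinct). -/
noncomputable def cardinalPoint (e : ExtremumKind) (g : ℝ → ℝ) (c : ℝ) (q i : ℕ) : ℝ :=
  (cardinalList e g c q).getD (i - 1) 0

/-- The reflection `R(a₁, …, aₙ; α) = (a₁, …, aₙ, aₙ + α, …, a₁ + α)`. -/
def reflection {A : Type*} [Add A] (l : List A) (α : A) : List A :=
  l ++ l.reverse.map (· + α)

/-- The iterated reflection `∂R(a₁, …, aₙ; 2 ^ k) = R(⋯R(R(a₁, …, aₙ; 2 ^ k); 2 ^ (k-1))⋯; 2 ^ 0)`,
as a function of the sequence and of `k`. -/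
def iteratedReflection {A : Type*} [Semiring A] : List A → ℕ → List A
  | l, 0 => reflection l (2 ^ 0)
  | l, k + 1 => iteratedReflection (reflection l (2 ^ (k + 1))) k

/-- `σ_{2^p} = ∂R(1, 2^(p-1) + 1; 2^(p-2))`, for `p ≥ 2`. -/
def sigmaList (p : ℕ) : List ℕ := iteratedReflection [1, 2 ^ (p - 1) + 1] (p - 2)

/-- The `i`-th entry `σ_(i,2^p)`, `1 ≤ i ≤ 2 ^ p`. -/
def sigma (p i : ℕ) : ℕ := (sigmaList p).getD (i - 1) 0

/-!
Write `y n = f^n(C)` for the superstable orbit. Two facts determine its order.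

* *Block structure.* For `m ≤ p` the residue classes modulo `2 ^ m` of the indices cut the orbit into
  blocks, and the order of two points in different blocks depends only on the blocks
  (`IsBlockOrdered`). Along a branch of the cascade two points of the orbit with indices in different
  classes never meet, so by continuity their order is the same for all parameters, including the
  bifurcation value, where the orbit coincides with that of half the period. Hence the order of the
  blocks is inherited from one branch to the next (`IsPeriodDoublingCascade.isBlockOrdered`).
* *Unimodality.* A block that does not contain `C = y 0` lies on one side of `C`, so the map is
  monotone on it. Among the blocks modulo `2 ^ k`, only that of `0` contains `C`; therefore the
  iterate with exponent `2 ^ k - 1` is monotone on the block of `y 1`, the maximal point. If it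
  preserves the order, it takes the pair `y (1 + 2 ^ k) < y 1` to points showing that the image of
  the subblock of `y 1` lies to the right of `C`, where one more step reverses the order; if it
  reverses the order, that image lies to the left of `C`, where one more step preserves it. In both
  cases the iterate with exponent `2 ^ k` reverses the order on the block of `y 1` modulo
  `2 ^ (k + 1)` (`UnimodalBlockOrbit.reverses`).

Consequently, if a list enumerates the block of `y 1` modulo `2 ^ (k + 1)` in descending order, its
reflection with shift `2 ^ k` enumerates the block of `y 1` modulo `2 ^ k` in descending order: this
is the recursion that defines `sigmaList`. A minimum is reduced to a maximum by replacing `y` with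
`-y`.
-/

/-! ### Block-ordered sequences -/

/-- The residue classes modulo `2 ^ m` of the indices are blocks for the order of the values of `y`:
the order of two values whose indices are in different classes depends only on these classes. -/
def IsBlockOrdered (m : ℕ) (y : ℕ → ℝ) : Prop :=
  ∀ i j i' j' : ℕ, i' ≡ i [MOD 2 ^ m] → j' ≡ j [MOD 2 ^ m] → ¬ i ≡ j [MOD 2 ^ m] →
    y i < y j → y i' < y j'

lemma IsBlockOrdered.neg {m : ℕ} {y : ℕ → ℝ} (h : IsBlockOrdered m y) :
    IsBlockOrdered m fun n => -y n := by
  intro i j i' j' hi hj hij hlt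
  exact neg_lt_neg (h j i j' i' hj hi (fun h' => hij h'.symm) (neg_lt_neg_iff.mp hlt))

lemma IsBlockOrdered.shift {m : ℕ} {y : ℕ → ℝ} (h : IsBlockOrdered m y) (a : ℕ) :
    IsBlockOrdered m fun n => y (n + a) := by
  intro i j i' j' hi hj hij hlt
  exact h _ _ _ _ (hi.add_right a) (hj.add_right a)
    (fun h' => hij (Nat.ModEq.add_right_cancel' a h')) hlt

/-! ### Order of the orbit along the cascade -/

lemma iterate_eq_iterate_iff_modEq {g : ℝ → ℝ} {z : ℝ} {q : ℕ} (hq : 0 < q)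
    (h : Function.minimalPeriod g z = q) (i j : ℕ) : g^[i] z = g^[j] z ↔ i ≡ j [MOD q] := by
  subst h
  rw [← Function.iterate_mod_minimalPeriod_eq (n := i),
    ← Function.iterate_mod_minimalPeriod_eq (n := j),
    Function.iterate_eq_iterate_iff_of_lt_minimalPeriod (Nat.mod_lt _ hq) (Nat.mod_lt _ hq)]
  rfl

lemma lt_of_continuousOn_of_forall_ne {a b : ℝ} {u v : ℝ → ℝ} (hu : ContinuousOn u (Icc a b))
    (hv : ContinuousOn v (Icc a b)) (hne : ∀ t ∈ Icc a b, u t ≠ v t) {t t' : ℝ}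
    (ht : t ∈ Icc a b) (ht' : t' ∈ Icc a b) (hlt : u t < v t) : u t' < v t' := by
  by_contra! hle
  obtain ⟨w, hw, h⟩ := isPreconnected_Icc.intermediate_value₂ ht ht' hu hv hlt.le hle
  exact hne w hw h

lemma IsUnimodalFamily.iterate_mem {e : ExtremumKind} {I Λ : Set ℝ} {f : ℝ → ℝ → ℝ} {c : ℝ → ℝ}
    (hf : IsUnimodalFamily e I Λ f c) {t z : ℝ} (ht : t ∈ Λ) (hz : z ∈ I) (n : ℕ) :
    (f t)^[n] z ∈ I :=
  (hf.unimodal t ht).1.iterate n hz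

lemma IsPeriodDoublingCascade.Icc_subset {I Λ : Set ℝ} {f : ℝ → ℝ → ℝ} {r : ℕ → ℝ}
    {x : ℕ → ℝ → ℝ} (hc : IsPeriodDoublingCascade I Λ f r x) (hΛ : Λ.OrdConnected) (k : ℕ) :
    Icc (r k) (r (k + 1)) ⊆ Λ :=
  hΛ.out (hc.mem_param k) (hc.mem_param (k + 1))

lemma IsPeriodDoublingCascade.continuousOn_iterate {e : ExtremumKind} {I Λ : Set ℝ}
    {f : ℝ → ℝ → ℝ} {c : ℝ → ℝ} {r : ℕ → ℝ} {x : ℕ → ℝ → ℝ}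
    (hf : IsUnimodalFamily e I Λ f c) (hc : IsPeriodDoublingCascade I Λ f r x) (k n : ℕ) :
    ContinuousOn (fun t => (f t)^[n] (x k t)) (Icc (r k) (r (k + 1))) := by
  have hΛ := hc.Icc_subset hf.interval_Λ k
  induction n with
  | zero => exact hc.continuous_branch k
  | succ n ih =>
    simp only [Function.iterate_succ_apply']
    exact hf.continuous.comp (continuousOn_id.prodMk ih) fun t ht =>
      ⟨hΛ ht, hf.iterate_mem (hΛ ht) (hc.mem_interval k t ht) n⟩

/-- Each branch of the cascade inherits the order of its blocks from the preceding branch. -/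
lemma IsPeriodDoublingCascade.isBlockOrdered {e : ExtremumKind} {I Λ : Set ℝ}
    {f : ℝ → ℝ → ℝ} {c : ℝ → ℝ} {r : ℕ → ℝ} {x : ℕ → ℝ → ℝ}
    (hf : IsUnimodalFamily e I Λ f c) (hc : IsPeriodDoublingCascade I Λ f r x) (k : ℕ) :
    ∀ t ∈ Ioc (r k) (r (k + 1)), ∀ m ≤ k, IsBlockOrdered m fun n => (f t)^[n] (x k t) := by
  induction k with
  | zero =>
    intro t _ m hm i j i' j' _ _ hij
    obtain rfl : m = 0 := by omega
    exact absurd (by simpa using Nat.modEq_one) hij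
  | succ k ih =>
    intro t ht m hm i j i' j' hi hj hij hlt
    have hlt_r : r (k + 1) < r (k + 1 + 1) := hc.strictMono (Nat.lt_succ_self _)
    rcases hm.eq_or_lt with rfl | hm
    · have hper := iterate_eq_iterate_iff_modEq (by positivity) (hc.least_period _ t ht)
      simpa only [(hper i' i).2 hi, (hper j' j).2 hj] using hlt
    have hmk : m ≤ k := by omega
    have hr : r (k + 1) ∈ Ioc (r k) (r (k + 1)) :=
      ⟨hc.strictMono (Nat.lt_succ_self _), le_rfl⟩
    -- At the left end point the branch has half the period, still a multiple of `2 ^ m`.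
    have hne : ∀ a b : ℕ, ¬ a ≡ b [MOD 2 ^ m] → ∀ w ∈ Icc (r (k + 1)) (r (k + 1 + 1)),
        (f w)^[a] (x (k + 1) w) ≠ (f w)^[b] (x (k + 1) w) := by
      intro a b hab w hw heq
      rcases hw.1.eq_or_lt with rfl | hw'
      · rw [hc.branching k, iterate_eq_iterate_iff_modEq (by positivity)
          (hc.least_period k _ hr)] at heq
        exact hab (heq.of_dvd (pow_dvd_pow 2 hmk))
      · rw [iterate_eq_iterate_iff_modEq (by positivity)
          (hc.least_period (k + 1) w ⟨hw', hw.2⟩)] at heq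
        exact hab (heq.of_dvd (pow_dvd_pow 2 hm.le))
    have hij' : ¬ i' ≡ j' [MOD 2 ^ m] := fun h => hij ((hi.symm.trans h).trans hj)
    have hcont := hc.continuousOn_iterate hf (k + 1)
    have h0 : r (k + 1) ∈ Icc (r (k + 1)) (r (k + 1 + 1)) := ⟨le_rfl, hlt_r.le⟩
    have h1 := lt_of_continuousOn_of_forall_ne (hcont i) (hcont j) (hne i j hij)
      (Ioc_subset_Icc_self ht) h0 hlt
    refine lt_of_continuousOn_of_forall_ne (hcont i') (hcont j') (hne i' j' hij')
      h0 (Ioc_subset_Icc_self ht) ?_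
    simp only [hc.branching k] at h1 ⊢
    exact ih _ hr m hmk i j i' j' hi hj hij h1

/-! ### Unimodal block-ordered orbits -/

/-- The order properties of an orbit `y` of least period `2 ^ p` of a unimodal map with a maximum at
`y 0`: it is block-ordered at every level up to `p`, and the step `y n ↦ y (n + 1)` preserves the
order to the left of `y 0` and reverses it to the right of `y 0`. -/
structure UnimodalBlockOrbit (p : ℕ) (y : ℕ → ℝ) : Prop where
  eq_iff : ∀ i j, y i = y j ↔ i ≡ j [MOD 2 ^ p]
  blocks : ∀ m ≤ p, IsBlockOrdered m y
  left : ∀ i j, y i < y j → y j ≤ y 0 → y (i + 1) < y (j + 1)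
  right : ∀ i j, y i < y j → y 0 ≤ y i → y (j + 1) < y (i + 1)

namespace UnimodalBlockOrbit

variable {p : ℕ} {y : ℕ → ℝ}

lemma ne_of_not_modEq (h : UnimodalBlockOrbit p y) {m i j : ℕ} (hm : m ≤ p)
    (hij : ¬ i ≡ j [MOD 2 ^ m]) : y i ≠ y j := fun he =>
  hij (((h.eq_iff i j).1 he).of_dvd (pow_dvd_pow 2 hm))

lemma lt_apply_one (h : UnimodalBlockOrbit p y) {j : ℕ} (hj : ¬ j ≡ 1 [MOD 2 ^ p]) : y j < y 1 := by
  have key : ∀ n, ¬ n + 1 ≡ 1 [MOD 2 ^ p] → y (n + 1) < y 1 := by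
    intro n hn
    have hn0 : ¬ n ≡ 0 [MOD 2 ^ p] := fun h' => hn (h'.add_right 1)
    rcases lt_or_gt_of_ne (h.ne_of_not_modEq le_rfl hn0) with hlt | hlt
    · exact h.left n 0 hlt le_rfl
    · exact h.right 0 n hlt le_rfl
  have hp : 0 < 2 ^ p := by positivity
  have hmod : j + 2 ^ p ≡ j [MOD 2 ^ p] := by simp [Nat.ModEq]
  have := key (j + 2 ^ p - 1) (by
    rw [Nat.sub_add_cancel (by omega)]
    exact fun h' => hj (hmod.symm.trans h'))
  rwa [Nat.sub_add_cancel (by omega), (h.eq_iff _ _).2 hmod] at this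

lemma not_modEq_add_two_pow (a k : ℕ) : ¬ a + 2 ^ k ≡ a [MOD 2 ^ (k + 1)] := by
  intro h
  have h0 : 2 ^ k ≡ 0 [MOD 2 ^ (k + 1)] := Nat.ModEq.add_left_cancel' a h
  have := Nat.le_of_dvd (by positivity) ((Nat.modEq_zero_iff_dvd).1 h0)
  rw [pow_succ] at this
  have : 0 < 2 ^ k := by positivity
  omega

/-- Of the two halves of the block of `1` modulo `2 ^ k`, the one of `1` is the upper one. -/
lemma lower_half_lt (h : UnimodalBlockOrbit p y) {k i j : ℕ} (hk : k + 1 ≤ p)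
    (hi : i ≡ 1 [MOD 2 ^ (k + 1)]) (hj : j ≡ 1 + 2 ^ k [MOD 2 ^ (k + 1)]) : y j < y i := by
  have hne := not_modEq_add_two_pow 1 k
  exact h.blocks (k + 1) hk (1 + 2 ^ k) 1 j i hj hi hne
    (h.lt_apply_one fun h' => hne (h'.of_dvd (pow_dvd_pow 2 hk)))

/-- Fewer than `2 ^ k` steps from the block of `1` modulo `2 ^ k` do not start in the block of the
critical point, hence they are monotone on that block. -/
lemma monotone_or_antitone (h : UnimodalBlockOrbit p y) {k : ℕ} (hk : k ≤ p) (n : ℕ)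
    (hn : n < 2 ^ k) :
    (∀ i j, i ≡ 1 [MOD 2 ^ k] → j ≡ 1 [MOD 2 ^ k] → y i < y j → y (i + n) < y (j + n)) ∨
    (∀ i j, i ≡ 1 [MOD 2 ^ k] → j ≡ 1 [MOD 2 ^ k] → y i < y j → y (j + n) < y (i + n)) := by
  induction n with
  | zero => exact Or.inl fun i j _ _ hlt => hlt
  | succ n ih =>
    have h0 : ¬ 1 + n ≡ 0 [MOD 2 ^ k] := fun h' => by
      have := Nat.le_of_dvd (by omega) ((Nat.modEq_zero_iff_dvd).1 h')
      omega
    have h0' : ¬ 0 ≡ 1 + n [MOD 2 ^ k] := fun h' => h0 h'.symm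
    rcases lt_or_gt_of_ne (h.ne_of_not_modEq hk h0) with hlt | hlt
    · have hL : ∀ i, i ≡ 1 [MOD 2 ^ k] → y (i + n) < y 0 := fun i hi =>
        h.blocks k hk _ _ _ _ (hi.add_right n) rfl h0 hlt
      rcases ih (by omega) with ih | ih
      · exact Or.inl fun i j hi hj hij => h.left _ _ (ih i j hi hj hij) (hL j hj).le
      · exact Or.inr fun i j hi hj hij => h.left _ _ (ih i j hi hj hij) (hL i hi).le
    · have hR : ∀ i, i ≡ 1 [MOD 2 ^ k] → y 0 < y (i + n) := fun i hi =>
        h.blocks k hk _ _ _ _ rfl (hi.add_right n) h0' hlt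
      rcases ih (by omega) with ih | ih
      · exact Or.inr fun i j hi hj hij => h.right _ _ (ih i j hi hj hij) (hR i hi).le
      · exact Or.inl fun i j hi hj hij => h.right _ _ (ih i j hi hj hij) (hR j hj).le

/-- The shift by `2 ^ k` reverses the order on the block of `1` modulo `2 ^ (k + 1)`. -/
lemma reverses (h : UnimodalBlockOrbit p y) {k i j : ℕ} (hk : k + 1 ≤ p)
    (hi : i ≡ 1 [MOD 2 ^ (k + 1)]) (hj : j ≡ 1 [MOD 2 ^ (k + 1)]) (hij : y i < y j) :
    y (j + 2 ^ k) < y (i + 2 ^ k) := by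
  have hpos : 0 < 2 ^ k := by positivity
  obtain ⟨n, hn⟩ : ∃ n, 2 ^ k = n + 1 := ⟨2 ^ k - 1, by omega⟩
  have hdvd : 2 ^ k ∣ 2 ^ (k + 1) := pow_dvd_pow 2 (Nat.le_succ k)
  have h1 : y (1 + 2 ^ k) < y 1 := h.lower_half_lt hk rfl rfl
  have hmod : 1 + 2 ^ k ≡ 1 [MOD 2 ^ k] := by simp [Nat.ModEq]
  -- The pair `1 + 2 ^ k`, `1` arrives at `2 ^ (k + 1)`, `2 ^ k` after `n = 2 ^ k - 1` steps.
  have hcrit : 1 + 2 ^ k + n ≡ 0 [MOD 2 ^ (k + 1)] := by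
    rw [show 1 + 2 ^ k + n = 2 ^ (k + 1) by rw [pow_succ]; omega]
    simp [Nat.ModEq]
  have hhalf : ∀ a, a ≡ 1 [MOD 2 ^ (k + 1)] → a + n ≡ 1 + n [MOD 2 ^ (k + 1)] :=
    fun a ha => ha.add_right n
  have hne : ¬ 1 + n ≡ 1 + 2 ^ k + n [MOD 2 ^ (k + 1)] := fun h' => by
    refine not_modEq_add_two_pow 0 k ?_
    have := h'.trans hcrit
    rwa [show 1 + n = 0 + 2 ^ k by omega] at this
  have hne' : ¬ 1 + 2 ^ k + n ≡ 1 + n [MOD 2 ^ (k + 1)] := fun h' => hne h'.symm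
  rw [hn, ← add_assoc, ← add_assoc]
  rcases h.monotone_or_antitone (k := k) (by omega) n (by omega) with hm | hm
  · have hside := h.blocks (k + 1) hk _ _ 0 (i + n) hcrit.symm (hhalf i hi) hne'
      (hm _ _ hmod rfl h1)
    exact h.right _ _ (hm i j (hi.of_dvd hdvd) (hj.of_dvd hdvd) hij) hside.le
  · have hside := h.blocks (k + 1) hk _ _ (i + n) 0 (hhalf i hi) hcrit.symm hne
      (hm _ _ hmod rfl h1)
    exact h.left _ _ (hm i j (hi.of_dvd hdvd) (hj.of_dvd hdvd) hij) hside.le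

/-! ### Reflections enumerate blocks in descending order -/

lemma pairwise_reflection (h : UnimodalBlockOrbit p y) {k : ℕ} (hk : k + 1 ≤ p) {l : List ℕ}
    (hl : ∀ a ∈ l, a ≡ 1 [MOD 2 ^ (k + 1)]) (hpw : l.Pairwise fun a b => y b < y a) :
    (reflection l (2 ^ k)).Pairwise fun a b => y b < y a := by
  rw [reflection, List.pairwise_append]
  refine ⟨hpw, ?_, ?_⟩
  · rw [List.pairwise_map, List.pairwise_reverse]
    exact hpw.imp_of_mem fun ha hb hab => h.reverses hk (hl _ hb) (hl _ ha) hab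
  · intro a ha b hb
    simp only [List.mem_map, List.mem_reverse] at hb
    obtain ⟨b, hb, rfl⟩ := hb
    exact h.lower_half_lt hk (hl a ha) ((hl b hb).add_right _)

lemma modEq_of_mem_reflection {k : ℕ} {l : List ℕ} (hl : ∀ a ∈ l, a ≡ 1 [MOD 2 ^ (k + 1)]) :
    ∀ a ∈ reflection l (2 ^ k), a ≡ 1 [MOD 2 ^ k] := by
  have hdvd : 2 ^ k ∣ 2 ^ (k + 1) := pow_dvd_pow 2 (Nat.le_succ k)
  intro a ha
  simp only [reflection, List.mem_append, List.mem_map, List.mem_reverse] at ha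
  rcases ha with ha | ⟨b, hb, rfl⟩
  · exact (hl a ha).of_dvd hdvd
  · simpa [Nat.ModEq] using (hl b hb).of_dvd hdvd

lemma pairwise_iteratedReflection (h : UnimodalBlockOrbit p y) {k : ℕ} (hk : k + 1 ≤ p)
    {l : List ℕ} (hl : ∀ a ∈ l, a ≡ 1 [MOD 2 ^ (k + 1)])
    (hpw : l.Pairwise fun a b => y b < y a) :
    (iteratedReflection l k).Pairwise fun a b => y b < y a := by
  induction k generalizing l with
  | zero => exact h.pairwise_reflection hk hl hpw
  | succ k ih =>
    exact ih (by omega) (modEq_of_mem_reflection hl) (h.pairwise_reflection hk hl hpw)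

lemma pairwise_sigmaList (h : UnimodalBlockOrbit p y) (hp : 2 ≤ p) :
    (sigmaList p).Pairwise fun a b => y b < y a := by
  obtain ⟨k, rfl⟩ := Nat.exists_eq_add_of_le' hp
  rw [sigmaList, show k + 2 - 1 = k + 1 by omega, show k + 2 - 2 = k by omega]
  refine h.pairwise_iteratedReflection (by omega) ?_ ?_
  · simp [Nat.ModEq]
  · simpa using h.lower_half_lt (k := k + 1) (i := 1) (by omega) rfl
      (by rw [add_comm (2 ^ (k + 1)) 1])

end UnimodalBlockOrbit

/-! ### The list of indices is a permutation -/

lemma length_iteratedReflection {A : Type*} [Semiring A] (l : List A) (k : ℕ) :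
    (iteratedReflection l k).length = 2 ^ (k + 1) * l.length := by
  induction k generalizing l with
  | zero => simp [iteratedReflection, reflection]; ring
  | succ k ih =>
    rw [iteratedReflection, ih]
    simp [reflection]
    ring

lemma length_sigmaList {p : ℕ} (hp : 2 ≤ p) : (sigmaList p).length = 2 ^ p := by
  obtain ⟨k, rfl⟩ := Nat.exists_eq_add_of_le' hp
  rw [sigmaList, length_iteratedReflection, show k + 2 - 2 = k by omega]
  simp
  ring

lemma bounds_reflection {N k : ℕ} {l : List ℕ} (hl : ∀ a ∈ l, 1 ≤ a ∧ a + 2 ^ (k + 1) ≤ N) :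
    ∀ a ∈ reflection l (2 ^ k), 1 ≤ a ∧ a + 2 ^ k ≤ N := by
  have h2 : 2 ^ (k + 1) = 2 ^ k + 2 ^ k := by ring
  have hpos : 0 < 2 ^ k := by positivity
  intro a ha
  simp only [reflection, List.mem_append, List.mem_map, List.mem_reverse] at ha
  rcases ha with ha | ⟨b, hb, rfl⟩
  · have := hl a ha
    omega
  · have := hl b hb
    omega

lemma bounds_iteratedReflection {N k : ℕ} {l : List ℕ}
    (hl : ∀ a ∈ l, 1 ≤ a ∧ a + 2 ^ (k + 1) ≤ N) :
    ∀ a ∈ iteratedReflection l k, 1 ≤ a ∧ a + 1 ≤ N := by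
  induction k generalizing l with
  | zero => simpa [iteratedReflection] using bounds_reflection hl
  | succ k ih => exact ih (bounds_reflection hl)

lemma bounds_sigmaList {p : ℕ} (hp : 2 ≤ p) : ∀ a ∈ sigmaList p, 1 ≤ a ∧ a ≤ 2 ^ p := by
  obtain ⟨k, rfl⟩ := Nat.exists_eq_add_of_le' hp
  intro a ha
  rw [sigmaList, show k + 2 - 1 = k + 1 by omega, show k + 2 - 2 = k by omega] at ha
  have h2 : 2 ^ (k + 2) = 2 ^ (k + 1) + 2 ^ (k + 1) := by ring
  have hpos : 0 < 2 ^ (k + 1) := by positivity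
  have := bounds_iteratedReflection (N := 2 ^ (k + 2) + 1) (by
    intro b hb
    simp only [List.mem_cons, List.not_mem_nil, or_false] at hb
    rcases hb with rfl | rfl <;> omega) a ha
  omega

lemma sigmaList_perm {p : ℕ} (hp : 2 ≤ p) (hnd : (sigmaList p).Nodup) :
    (sigmaList p).Perm (List.range' 1 (2 ^ p)) := by
  refine (hnd.subperm fun a ha => ?_).perm_of_length_le (by simp [length_sigmaList hp])
  have := bounds_sigmaList hp a ha
  rw [List.mem_range'_1]
  omega

/-! ### The superstable orbit -/

/-- The superstable orbit, with its order reversed in the case of a minimum, is a unimodal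
block-ordered orbit. -/
lemma IsSuperstableParam.unimodalBlockOrbit {e : ExtremumKind} {I Λ : Set ℝ} {f : ℝ → ℝ → ℝ}
    {c : ℝ → ℝ} {r : ℕ → ℝ} {x : ℕ → ℝ → ℝ}
    (hf : IsUnimodalFamily e I Λ f c) (hc : IsPeriodDoublingCascade I Λ f r x)
    {p : ℕ} {s : ℝ} (hs : IsSuperstableParam f c r x p s) :
    UnimodalBlockOrbit p fun n => match e with
      | .max => (f s)^[n] (c s)
      | .min => -(f s)^[n] (c s) := by
  obtain ⟨hsI, a, ha⟩ := hs
  have hsΛ : s ∈ Λ := hc.Icc_subset hf.interval_Λ p (Ioo_subset_Icc_self hsI)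
  have hs' : s ∈ Ioc (r p) (r (p + 1)) := Ioo_subset_Ioc_self hsI
  have horb : ∀ n, (f s)^[n] (c s) = (f s)^[n + a] (x p s) := fun n => by
    rw [Function.iterate_add_apply, ha]
  have heq : ∀ i j, (f s)^[i] (c s) = (f s)^[j] (c s) ↔ i ≡ j [MOD 2 ^ p] := fun i j => by
    rw [horb, horb, iterate_eq_iterate_iff_modEq (by positivity) (hc.least_period p s hs')]
    exact ⟨Nat.ModEq.add_right_cancel' a, Nat.ModEq.add_right a⟩
  have hblk : ∀ m ≤ p, IsBlockOrdered m fun n => (f s)^[n] (c s) := fun m hm => by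
    simpa only [horb] using (hc.isBlockOrdered hf p s hs' m hm).shift a
  have hu := hf.unimodal s hsΛ
  have hI : ∀ n, (f s)^[n] (c s) ∈ I := hf.iterate_mem hsΛ (interior_subset hu.2.1)
  cases e with
  | max =>
    obtain ⟨-, -, -, hL, hR⟩ := hu
    refine ⟨heq, hblk, fun i j hij hj => ?_, fun i j hij hi => ?_⟩
    · simp only [Function.iterate_succ_apply']
      exact hL ⟨hI i, hij.le.trans hj⟩ ⟨hI j, hj⟩ hij
    · simp only [Function.iterate_succ_apply']
      exact hR ⟨hI i, hi⟩ ⟨hI j, hi.trans hij.le⟩ hij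
  | min =>
    obtain ⟨-, -, -, hL, hR⟩ := hu
    refine ⟨fun i j => neg_inj.trans (heq i j), fun m hm => (hblk m hm).neg,
      fun i j hij hj => ?_, fun i j hij hi => ?_⟩
    · simp only [Function.iterate_succ_apply', neg_lt_neg_iff] at hij ⊢
      have hj' : c s ≤ (f s)^[j] (c s) := neg_le_neg_iff.mp hj
      exact hR ⟨hI j, hj'⟩ ⟨hI i, hj'.trans hij.le⟩ hij
    · simp only [Function.iterate_succ_apply', neg_lt_neg_iff] at hij ⊢
      have hi' : (f s)^[i] (c s) ≤ c s := neg_le_neg_iff.mp hi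
      exact hL ⟨hI j, hij.le.trans hi'⟩ ⟨hI i, hi'⟩ hij

lemma orbitPoints_eq_toFinset {g : ℝ → ℝ} {z : ℝ} {q : ℕ} (hz : g^[q] z = z) {l : List ℕ}
    (hl : l.Perm (List.range' 1 q)) : orbitPoints g z q = (l.map fun n => g^[n] z).toFinset := by
  ext w
  simp only [orbitPoints, Finset.mem_image, Finset.mem_range, List.mem_toFinset, List.mem_map,
    hl.mem_iff, List.mem_range'_1]
  -- The index `0` on the left corresponds to the index `q` on the right.
  constructor
  · rintro ⟨j, hj, rfl⟩
    rcases Nat.eq_zero_or_pos j with rfl | h0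
    · exact ⟨q, by omega, hz⟩
    · exact ⟨j, by omega, rfl⟩
  · rintro ⟨j, hj, rfl⟩
    rcases Nat.lt_or_ge j q with h | h
    · exact ⟨j, h, rfl⟩
    · obtain rfl : j = q := by omega
      exact ⟨0, by omega, hz.symm⟩

theorem mainTheorem1 (e : ExtremumKind) (I Λ : Set ℝ) (f : ℝ → ℝ → ℝ) (c : ℝ → ℝ)
    (r : ℕ → ℝ) (x : ℕ → ℝ → ℝ)
    (hf : IsUnimodalFamily e I Λ f c) (hcascade : IsPeriodDoublingCascade I Λ f r x)
    (p : ℕ) (hp : 2 ≤ p) (s : ℝ) (hs : IsSuperstableParam f c r x p s) :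
    (sigmaList p).Perm (List.range' 1 (2 ^ p)) ∧
    (orbitPoints (f s) (c s) (2 ^ p)).card = 2 ^ p ∧
    (f s)^[2 ^ p] (c s) = c s ∧
    (∀ i : ℕ, 1 ≤ i → i ≤ 2 ^ p →
      (f s)^[sigma p i] (c s) = cardinalPoint e (f s) (c s) (2 ^ p) i) ∧
    (∀ y : ℕ → ℝ, (∀ j : ℕ, 1 ≤ j → j ≤ 2 ^ p → y j = (f s)^[j] (c s)) →
      ∀ i : ℕ, 1 ≤ i → i ≤ 2 ^ p →
        cardinalPoint e (f s) (c s) (2 ^ p) i = y (sigma p i)) := by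
  have h := hs.unimodalBlockOrbit hf hcascade
  have hpw := h.pairwise_sigmaList hp
  have hperm : (sigmaList p).Perm (List.range' 1 (2 ^ p)) :=
    sigmaList_perm hp (hpw.imp fun hab heq => by subst heq; exact lt_irrefl _ hab)
  have hper : (f s)^[2 ^ p] (c s) = c s := by
    have := (h.eq_iff (2 ^ p) 0).2 (by simp [Nat.ModEq])
    cases e with
    | max => exact this
    | min => exact neg_inj.mp this
  have hset := orbitPoints_eq_toFinset hper hperm
  have hnd : ((sigmaList p).map fun n => (f s)^[n] (c s)).Nodup := by
    rw [List.Nodup, List.pairwise_map]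
    cases e with
    | max => exact hpw.imp fun hab => hab.ne'
    | min => exact hpw.imp fun hab => (neg_lt_neg_iff.mp hab).ne
  have hlist : cardinalList e (f s) (c s) (2 ^ p) =
      (sigmaList p).map fun n => (f s)^[n] (c s) := by
    cases e with
    | max =>
      rw [cardinalList, hset]
      exact (List.toFinset_sort (· ≥ ·) hnd).2 (List.pairwise_map.2 (hpw.imp fun hab => hab.le))
    | min =>
      rw [cardinalList, hset]
      exact (List.toFinset_sort (· ≤ ·) hnd).2
        (List.pairwise_map.2 (hpw.imp fun hab => (neg_lt_neg_iff.mp hab).le))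
  have hlen := length_sigmaList hp
  have hpoint : ∀ i : ℕ, 1 ≤ i → i ≤ 2 ^ p →
      (f s)^[sigma p i] (c s) = cardinalPoint e (f s) (c s) (2 ^ p) i := by
    intro i h1 hi
    have hlt : i - 1 < (sigmaList p).length := by omega
    rw [cardinalPoint, hlist, sigma, List.getD_eq_getElem _ _ hlt,
      List.getD_eq_getElem _ _ (by simpa using hlt), List.getElem_map]
  refine ⟨hperm, ?_, hper, hpoint, fun y hy i h1 hi => ?_⟩
  · rw [hset, List.toFinset_card_of_nodup hnd, List.length_map, hlen]
  · have hlt : i - 1 < (sigmaList p).length := by omega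
    have hmem : sigma p i ∈ sigmaList p := by
      rw [sigma, List.getD_eq_getElem _ _ hlt]
      exact List.getElem_mem hlt
    have hb := bounds_sigmaList hp _ hmem
    rw [hy _ hb.1 hb.2, hpoint i h1 hi]
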